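/- A single machine must run $n$ jobs with unknown sizes $x_1,\dots,x_n\in(0,\infty)$; preemption is allowed, so jobs may be run in parallel at rates summing to at most $1$, and the objective is the sum of the completion times. A (deterministic or randomized) algorithm $\mathsf A$ is told exactly the sizes $x_{\sigma(1)},\dots,x_{\sigma(B)}$ of $B$ of the jobs, where $\sigma$ is a uniformly random permutation of $\{1,\dots,n\}$; apart from this its decisions may depend only on the job completions observed so far and on its own random choices. Let $\mathsf A(x)$ be the sum of the completion times achieved by $\mathsf A$ on $x=(x_1,\dots,x_n)$, let $\mathsf{OPT}(x)$ be the optimal offline value, and put \[ \mathsf R_{n,B}(\mathsf A)=\sup_{x\in(0,\infty)^n}\frac{\mathbb E[\mathsf A(x)]}{\mathsf{OPT}(x)}, \] the expectation being over $\sigma$ and the randomness of $\mathsf A$. Then for all $n\ge 2$, all $0\le B\le n$ and every algorithm $\mathsf A$, \[ \mathsf R_{n,B}(\mathsf A)\;\ge\; C_{n,B}-\frac{4\,(C_{n,B}-1)}{n+3}, \qquad C_{n,B}=2-\frac Bn-\Big(\frac4e-1\Big)\frac Bn\Big(1-\frac{B-1}{n-1}\Big). \] In particular, if the number of known sizes is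 a sequence $B=(B_n)_n$ of integers with $0\le B_n\le n$ and $B_n=wn+o(n)$ as $n\to\infty$ for some $w\in[0,1]$, then for every algorithm $\mathsf A$ \[ \mathsf{CR}_B(\mathsf A):=\sup_{n\ge2}\mathsf R_{n,B_n}(\mathsf A)\;\ge\;(2-w)-\Big(\frac4e-1\Big)w(1-w). \] -/

import Mathlib

open MeasureTheory Filter Asymptotics
open scoped NNReal ENNReal

universe u

namespace PartialScheduling

/-- `S i t` is the processing time spent on job `i` until time `t`. `S` is a feasible preemptive
single-machine schedule of jobs of sizes `x` when the jobs are run in parallel at rates that sum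
to at most `1`, and a job is not run any more once it is complete. -/
structure IsSchedule {n : ℕ} (x : Fin n → ℝ≥0) (S : Fin n → ℝ≥0 → ℝ≥0) : Prop where
  zero : ∀ i, S i 0 = 0
  mono : ∀ i, Monotone (S i)
  rate : ∀ s d : ℝ≥0, ∑ i, S i (s + d) ≤ ∑ i, S i s + d
  le_size : ∀ i t, S i t ≤ x i

/-- The completion time `inf {t ≥ 0 : S i t = x i}` of job `i`; it is `∞` when the job is never
completed. -/
noncomputable def completionTime {n : ℕ} (x : Fin n → ℝ≥0) (S : Fin n → ℝ≥0 → ℝ≥0) (i : Fin n) :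
    ℝ≥0∞ :=
  ⨅ (t : ℝ≥0) (_ : S i t = x i), (t : ℝ≥0∞)

/-- The objective: the sum of the completion times of all the jobs. -/
noncomputable def totalCompletionTime {n : ℕ} (x : Fin n → ℝ≥0) (S : Fin n → ℝ≥0 → ℝ≥0) : ℝ≥0∞ :=
  ∑ i, completionTime x S i

/-- The optimal offline objective: the least sum of completion times over all feasible schedules
of the instance `x`. -/
noncomputable def opt {n : ℕ} (x : Fin n → ℝ≥0) : ℝ≥0∞ :=
  ⨅ (S : Fin n → ℝ≥0 → ℝ≥0) (_ : IsSchedule x S), totalCompletionTime x S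

/-- A deterministic algorithm for `n` jobs that has access to the sizes of the `B` jobs
`σ 0, …, σ (B - 1)`, where `σ` is a permutation of the jobs. `run σ x` is the schedule that it
produces on the instance `x`.

The field `nonanticipating` says that the algorithm acts only on the information available to it:
the indices and the sizes of the known jobs, and the completions observed so far. Consider two
instances `x`, `x'` (and permutations `σ`, `σ'`) with the same known jobs of the same sizes, and a
time `t` at which, in the run on `x`, every job whose sizes in `x` and `x'` differ has been processed
for less than both sizes. Nothing that is observed until time `t` distinguishes the
two situations, hence the two runs agree until time `t`. -/
structure DetAlgorithm (n B : ℕ) where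
  run : Equiv.Perm (Fin n) → (Fin n → ℝ≥0) → Fin n → ℝ≥0 → ℝ≥0
  isSchedule : ∀ (σ : Equiv.Perm (Fin n)) (x : Fin n → ℝ≥0), (∀ i, 0 < x i) →
    IsSchedule x (run σ x)
  nonanticipating : ∀ (σ σ' : Equiv.Perm (Fin n)) (x x' : Fin n → ℝ≥0),
    (∀ i, 0 < x i) → (∀ i, 0 < x' i) →
    (∀ k : Fin n, (k : ℕ) < B → σ' k = σ k ∧ x' (σ k) = x (σ k)) →
    ∀ t : ℝ≥0, (∀ i, x' i = x i ∨ (run σ x i t < x i ∧ run σ x i t < x' i)) →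
      ∀ i, ∀ s ≤ t, run σ' x' i s = run σ x i s

/-- A (possibly randomized) algorithm: a deterministic algorithm chosen by a random seed.
Deterministic algorithms are those with a one-point seed space. -/
structure Algorithm (n B : ℕ) where
  Seed : Type u
  [measurableSpace : MeasurableSpace Seed]
  law : Measure Seed
  [isProbabilityMeasure : IsProbabilityMeasure law]
  det : Seed → DetAlgorithm n B
  measurable_run : ∀ (σ : Equiv.Perm (Fin n)) (x : Fin n → ℝ≥0), (∀ i, 0 < x i) →
    ∀ (i : Fin n) (t : ℝ≥0), Measurable fun ω => (det ω).run σ x i t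

attribute [instance] Algorithm.measurableSpace Algorithm.isProbabilityMeasure

/-- The expected objective of `A` on the instance `x`, over a uniformly random permutation `σ` of
the jobs and over the independent random seed of `A`. -/
noncomputable def Algorithm.expectedCost {n B : ℕ} (A : Algorithm.{u} n B) (x : Fin n → ℝ≥0) :
    ℝ≥0∞ :=
  (∑ σ : Equiv.Perm (Fin n), ∫⁻ ω, totalCompletionTime x ((A.det ω).run σ x) ∂A.law) /
    (n.factorial : ℝ≥0∞)

/-- The `(n, B)`-competitive ratio of `A`: the supremum over `x ∈ (0, ∞)ⁿ` of the ratio of the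
expected objective of `A` to the offline optimum. -/
noncomputable def Algorithm.ratio {n B : ℕ} (A : Algorithm.{u} n B) : ℝ≥0∞ :=
  ⨆ (x : Fin n → ℝ≥0) (_ : ∀ i, 0 < x i), A.expectedCost x / opt x

/-- The competitive ratio of an algorithm that, on `n` jobs, has access to `B n` job sizes: the
supremum over `n ≥ 2` of its `(n, B n)`-competitive ratios. -/
noncomputable def competitiveRatio {B : ℕ → ℕ} (A : ∀ n, Algorithm.{u} n (B n)) : ℝ≥0∞ :=
  ⨆ (n : ℕ) (_ : 2 ≤ n), (A n).ratio

/-- The constant `C_{n,B} = 2 - B/n - (4/e - 1) (B/n) (1 - (B-1)/(n-1))`. -/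
noncomputable def boundConst (n B : ℕ) : ℝ :=
  2 - (B : ℝ) / n - (4 / Real.exp 1 - 1) * ((B : ℝ) / n) * (1 - ((B : ℝ) - 1) / ((n : ℝ) - 1))

end PartialScheduling

/-!
The bound is an averaging argument over random job sizes. If the sizes are independent exponential
variables of mean `1`, then `OPT` is the total size plus `min (x i) (x j)` for every pair, so that
`𝔼 OPT = n + n (n - 1) / 4`. The cost of an algorithm is at least the total size plus, for every
pair `i`, `j`, the delay that the two jobs cause to each other: the work on `i` before `j` is
complete plus the work on `j` before `i` is complete. Each of the two is the work on one of the
jobs until the first of the two completions. By memorylessness, the expected work on a hidden job until some event is at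
least the probability that the job is complete by then. Hence the expected delay of a pair is at
least `1` if both jobs are hidden, `𝔼 min(X, 1) = 1 - 1/e` if one of them is known, and
`𝔼 min(X, Y) = 1/2` if both are. Summing over the pairs and dividing by `𝔼 OPT` gives exactly the
claimed constant, and some instance is at least as bad as the average.

Runs of an algorithm need not be measurable in the sizes, so the exponential law is replaced by a
geometric law on the multiples of `1 / m`: its support is countable, it is memoryless, its mean is
exactly `1`, and every lower bound above survives for each `m ≥ 2`; only `𝔼 OPT` is slightly larger,
with `1 / (2 - 1/m)` in place of `1/2`, and the limit `m → ∞` removes this loss.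

Memorylessness enters only through `lintegral_sum_range_geomLaw`; it is combined with the
nonanticipation of the algorithm in `DetAlgorithm.CompletesGrid.lintegral_gridWork_ge`. The
exchange of the expectations over the sizes and over the seed is made in `Algorithm.ratio_mul_ge`.
-/

namespace PartialScheduling

/-! ### Schedules, delays and the offline optimum -/

section Schedules

variable {n : ℕ} {x : Fin n → ℝ≥0} {S : Fin n → ℝ≥0 → ℝ≥0}

lemma IsSchedule.apply_add_le (h : IsSchedule x S) (i : Fin n) (s d : ℝ≥0) :
    S i (s + d) ≤ S i s + d := by
  have h1 := h.rate s d
  rw [← Finset.add_sum_erase _ _ (Finset.mem_univ i),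
    ← Finset.add_sum_erase _ (fun i => S i s) (Finset.mem_univ i)] at h1
  have h2 : ∑ k ∈ Finset.univ.erase i, S k s ≤ ∑ k ∈ Finset.univ.erase i, S k (s + d) :=
    Finset.sum_le_sum fun k _ => h.mono k le_self_add
  have h3 : S i (s + d) + ∑ k ∈ Finset.univ.erase i, S k s ≤
      (S i s + d) + ∑ k ∈ Finset.univ.erase i, S k s := by
    calc _ ≤ S i (s + d) + ∑ k ∈ Finset.univ.erase i, S k (s + d) := by gcongr
      _ ≤ _ := h1
      _ = _ := by ring
  exact le_of_add_le_add_right h3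

lemma IsSchedule.sum_apply_le (h : IsSchedule x S) (t : ℝ≥0) : ∑ i, S i t ≤ t := by
  simpa [h.zero] using h.rate 0 t

lemma completionTime_le_of_apply_eq {i : Fin n} {t : ℝ≥0} (h : S i t = x i) :
    completionTime x S i ≤ t :=
  iInf₂_le t h

/-- The infimum defining a finite completion time is attained, since a schedule is continuous. -/
lemma IsSchedule.apply_completionTime (h : IsSchedule x S) {i : Fin n}
    (hi : completionTime x S i ≠ ⊤) : S i (completionTime x S i).toNNReal = x i := by
  refine le_antisymm (h.le_size i _) (le_of_forall_pos_le_add fun δ hδ => ?_)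
  have hlt : completionTime x S i < completionTime x S i + δ :=
    ENNReal.lt_add_right hi (by simpa using hδ.ne')
  obtain ⟨t, ht⟩ := iInf_lt_iff.1 hlt
  obtain ⟨hit, ht⟩ := iInf_lt_iff.1 ht
  rw [← hit]
  refine le_trans (h.mono i ?_) (h.apply_add_le i _ δ)
  rw [← ENNReal.coe_le_coe, ENNReal.coe_add, ENNReal.coe_toNNReal hi]
  exact ht.le

/-- The time spent on job `i` before job `j` is complete, meaningful when the completion time of
`j` is finite. -/
noncomputable def workBefore (x : Fin n → ℝ≥0) (S : Fin n → ℝ≥0 → ℝ≥0) (i j : Fin n) : ℝ≥0 :=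
  S i (completionTime x S j).toNNReal

lemma IsSchedule.sum_workBefore_le (h : IsSchedule x S) {j : Fin n}
    (hj : completionTime x S j ≠ ⊤) :
    (x j : ℝ≥0∞) + ∑ i ∈ Finset.univ.erase j, (workBefore x S i j : ℝ≥0∞) ≤
      completionTime x S j := by
  have h1 := h.sum_apply_le (completionTime x S j).toNNReal
  rw [← Finset.add_sum_erase _ _ (Finset.mem_univ j), h.apply_completionTime hj] at h1
  calc _ = ((x j + ∑ i ∈ Finset.univ.erase j, workBefore x S i j : ℝ≥0) : ℝ≥0∞) := by push_cast; rfl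
    _ ≤ ((completionTime x S j).toNNReal : ℝ≥0∞) := by exact_mod_cast h1
    _ = _ := ENNReal.coe_toNNReal hj

/-- Of two jobs, the one that finishes first is fully processed before the other is complete. -/
lemma IsSchedule.workBefore_eq_or (h : IsSchedule x S) {i j : Fin n}
    (hi : completionTime x S i ≠ ⊤) (hj : completionTime x S j ≠ ⊤) :
    workBefore x S i j = x i ∨ workBefore x S j i = x j := by
  rcases le_total (completionTime x S i) (completionTime x S j) with hij | hij
  · left
    refine le_antisymm (h.le_size i _) ?_
    rw [← h.apply_completionTime hi]
    exact h.mono i (ENNReal.toNNReal_mono hj hij)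
  · right
    refine le_antisymm (h.le_size j _) ?_
    rw [← h.apply_completionTime hj]
    exact h.mono j (ENNReal.toNNReal_mono hi hij)

/-- Twice the objective dominates twice the total size plus the work of every ordered pair. -/
lemma IsSchedule.two_mul_total_ge (h : IsSchedule x S) (hf : ∀ i, completionTime x S i ≠ ⊤) :
    2 * ∑ j, (x j : ℝ≥0∞) + ∑ j, ∑ i ∈ Finset.univ.erase j,
      ((workBefore x S i j : ℝ≥0∞) + workBefore x S j i) ≤ 2 * totalCompletionTime x S := by
  have hswap : ∑ j, ∑ i ∈ Finset.univ.erase j, (workBefore x S j i : ℝ≥0∞) =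
      ∑ j, ∑ i ∈ Finset.univ.erase j, (workBefore x S i j : ℝ≥0∞) := by
    refine Finset.sum_comm' fun a b => ?_
    simp [eq_comm]
  have h1 : ∑ j, ((x j : ℝ≥0∞) + ∑ i ∈ Finset.univ.erase j, (workBefore x S i j : ℝ≥0∞)) ≤
      totalCompletionTime x S := Finset.sum_le_sum fun j _ => h.sum_workBefore_le (hf j)
  calc _ = 2 * ∑ j, ((x j : ℝ≥0∞) +
        ∑ i ∈ Finset.univ.erase j, (workBefore x S i j : ℝ≥0∞)) := by
        simp only [Finset.sum_add_distrib]
        rw [hswap]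
        ring
    _ ≤ _ := by gcongr

/-- Shortest processing time first: job `π i` is run for `min (x (π i)) (t - ∑ k < i, x (π k))`
up to time `t`, where `π` sorts the sizes. -/
lemma two_mul_opt_le (x : Fin n → ℝ≥0) :
    2 * opt x ≤ ∑ i, (x i : ℝ≥0∞) + ∑ i, ∑ j, ((min (x i) (x j) : ℝ≥0) : ℝ≥0∞) := by
  set π := Tuple.sort x
  have hmono : Monotone (x ∘ π) := Tuple.monotone_sort x
  -- Prefix sums of the sorted sizes, indexed by `ℕ` so that the sum of the rates telescopes.
  let a : ℕ → ℝ≥0 := fun k => if h : k < n then x (π ⟨k, h⟩) else 0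
  let P : ℕ → ℝ≥0 := fun k => ∑ l ∈ Finset.range k, a l
  have ha : ∀ i : Fin n, a i = x (π i) := fun i => by simp [a]
  let T : ℕ → ℝ≥0 → ℝ≥0 := fun k t => min (a k) (t - P k)
  have hT : ∀ N t, ∑ k ∈ Finset.range N, T k t = min (P N) t := by
    intro N t
    induction N with
    | zero => simp [P]
    | succ N ih =>
      rw [Finset.sum_range_succ, ih]
      have : P (N + 1) = P N + a N := Finset.sum_range_succ _ _
      rw [this]
      rcases le_total (P N) t with h | h
      · rw [min_eq_left h]
        obtain ⟨d, rfl⟩ := exists_add_of_le h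
        simp [T, min_add_add_left]
      · rw [min_eq_right h, min_eq_right (h.trans le_self_add)]
        simp [T, tsub_eq_zero_of_le h]
  let S : Fin n → ℝ≥0 → ℝ≥0 := fun i t => T (π.symm i) t
  have hsum : ∀ t, ∑ i, S i t = min (P n) t := by
    intro t
    rw [← hT n t, Finset.sum_range, ← Equiv.sum_comp π]
    simp [S]
  have hS : IsSchedule x S := by
    refine ⟨fun i => by simp [S, T], fun i s t hst => ?_, fun s d => ?_, fun i t => ?_⟩
    · exact min_le_min le_rfl (tsub_le_tsub_right hst _)
    · rw [hsum, hsum]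
      rcases le_total (P n) s with h | h
      · exact (min_le_left _ _).trans (by rw [min_eq_left h]; exact le_self_add)
      · rw [min_eq_right h]; exact min_le_right _ _
    · refine (min_le_left _ _).trans ?_
      rw [ha]; simp
  have hC : ∀ i : Fin n, completionTime x S (π i) ≤ ((P (i + 1) : ℝ≥0) : ℝ≥0∞) := by
    intro i
    refine completionTime_le_of_apply_eq ?_
    have : P (i + 1) = P i + a i := Finset.sum_range_succ _ _
    simp [S, T, this, ha]
  have hP : ∀ i : Fin n, P (i + 1) = ∑ k : Fin n, if k ≤ i then x (π k) else 0 := by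
    intro i
    have h1 : P (i + 1) = ∑ k ∈ Finset.range n, if k ≤ (i : ℕ) then a k else 0 := by
      rw [← Finset.sum_filter]
      refine Finset.sum_congr ?_ fun _ _ => rfl
      ext k
      have := i.2
      simp only [Finset.mem_range, Finset.mem_filter]
      omega
    rw [h1, Finset.sum_range]
    simp [ha]
  have hopt : opt x ≤ ((∑ i : Fin n, ∑ k : Fin n, if k ≤ i then x (π k) else 0 : ℝ≥0) : ℝ≥0∞) := by
    refine (iInf₂_le S hS).trans ?_
    unfold totalCompletionTime
    rw [← Equiv.sum_comp π, ENNReal.ofNNReal_finsetSum]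
    exact Finset.sum_le_sum fun i _ => by rw [← hP]; exact hC i
  have hpair : ∀ i k : Fin n, (if k ≤ i then x (π k) else 0) + (if i ≤ k then x (π i) else 0) =
      min (x (π i)) (x (π k)) + if i = k then x (π i) else 0 := by
    intro i k
    rcases lt_trichotomy i k with h | h | h
    · have := hmono h.le
      simp only [Function.comp] at this
      simp [h.le, h.ne, h.not_ge, this]
    · simp [h]
    · have := hmono h.le
      simp only [Function.comp] at this
      simp [h.le, h.ne', h.not_ge, this]
  have hswap : ∑ i : Fin n, ∑ k : Fin n, (if k ≤ i then x (π k) else 0) =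
      ∑ i : Fin n, ∑ k : Fin n, (if i ≤ k then x (π i) else 0) := Finset.sum_comm
  have key : 2 * ∑ i : Fin n, ∑ k : Fin n, (if k ≤ i then x (π k) else 0) =
      ∑ i, x i + ∑ i, ∑ j, min (x i) (x j) := by
    calc _ = ∑ i : Fin n, ∑ k : Fin n,
          ((if k ≤ i then x (π k) else 0) + (if i ≤ k then x (π i) else 0)) := by
          simp only [Finset.sum_add_distrib]
          rw [← hswap, two_mul]
      _ = ∑ i, x (π i) + ∑ i, ∑ j, min (x (π i)) (x (π j)) := by
          simp only [hpair, Finset.sum_add_distrib]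
          simp [add_comm]
      _ = _ := by
          rw [Equiv.sum_comp π x]
          congr 1
          rw [Equiv.sum_comp π (fun i => ∑ j, min (x i) (x (π j)))]
          exact Finset.sum_congr rfl fun i _ => Equiv.sum_comp π (fun j => min (x i) (x j))
  calc 2 * opt x ≤ 2 * ((∑ i : Fin n, ∑ k : Fin n,
        if k ≤ i then x (π k) else 0 : ℝ≥0) : ℝ≥0∞) := by gcongr
    _ = ((2 * ∑ i : Fin n, ∑ k : Fin n, (if k ≤ i then x (π k) else 0) : ℝ≥0) : ℝ≥0∞) := by
        push_cast; rfl
    _ = _ := by rw [key]; push_cast; rfl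

/-- The objective of a randomly seeded algorithm is a random variable, although the infimum in the
completion time ranges over uncountably many times. -/
lemma measurable_totalCompletionTime {Ω : Type*} [MeasurableSpace Ω] (x : Fin n → ℝ≥0)
    (S : Ω → Fin n → ℝ≥0 → ℝ≥0) (hS : ∀ ω, IsSchedule x (S ω))
    (hm : ∀ i t, Measurable fun ω => S ω i t) :
    Measurable fun ω => totalCompletionTime x (S ω) := by
  refine Finset.measurable_sum _ fun i _ => ?_
  refine measurable_of_Iic fun t => ?_
  rcases eq_or_ne t ⊤ with rfl | ht
  · simp
  have : (fun ω => completionTime x (S ω) i) ⁻¹' Set.Iic t =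
      (fun ω => S ω i t.toNNReal) ⁻¹' {x i} := by
    ext ω
    simp only [Set.mem_preimage, Set.mem_Iic, Set.mem_singleton_iff]
    constructor
    · intro h
      refine le_antisymm ((hS ω).le_size i _) ?_
      rw [← (hS ω).apply_completionTime (ne_top_of_le_ne_top ht h)]
      exact (hS ω).mono i (ENNReal.toNNReal_mono ht h)
    · intro h
      simpa [ENNReal.coe_toNNReal ht] using completionTime_le_of_apply_eq h
  rw [this]
  exact hm i _ (measurableSet_singleton _)

end Schedules

/-! ### Geometrically distributed job sizes -/

section GeometricSizes

/-- The geometric law on `ℕ` with success probability `1 / m`. -/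
noncomputable def geomLaw (m : ℕ) : Measure ℕ :=
  Measure.sum fun k => ((m : ℝ≥0∞)⁻¹ * (1 - (m : ℝ≥0∞)⁻¹) ^ k) • Measure.dirac k

/-- The size `(k + 1) / m` that is attached to the outcome `k` of the geometric law. Its law has
mean `1` and is the discrete counterpart of the exponential law. -/
noncomputable def gridSize (m k : ℕ) : ℝ≥0 := (k + 1) / m

lemma lintegral_geomLaw (m : ℕ) (f : ℕ → ℝ≥0∞) :
    ∫⁻ k, f k ∂geomLaw m = ∑' k, (m : ℝ≥0∞)⁻¹ * (1 - (m : ℝ≥0∞)⁻¹) ^ k * f k := by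
  simp [geomLaw, lintegral_sum_measure]

lemma gridSize_mono (m : ℕ) : Monotone (gridSize m) := fun _ _ _ => by
  unfold gridSize
  gcongr

variable (m : ℕ) [m.AtLeastTwo]

lemma inv_natCast_lt_one : (m : ℝ≥0∞)⁻¹ < 1 := by
  rw [ENNReal.inv_lt_one]
  exact_mod_cast Nat.AtLeastTwo.one_lt

lemma inv_mul_tsum_geometric :
    (m : ℝ≥0∞)⁻¹ * ∑' k : ℕ, (1 - (m : ℝ≥0∞)⁻¹) ^ k = 1 := by
  rw [ENNReal.tsum_geometric, ENNReal.sub_sub_cancel ENNReal.one_ne_top (inv_natCast_lt_one m).le,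
    ENNReal.mul_inv_cancel] <;> simp [NeZero.ne m]

instance : IsProbabilityMeasure (geomLaw m) := by
  constructor
  rw [← lintegral_one, lintegral_geomLaw]
  simp only [mul_one]
  rw [ENNReal.tsum_mul_left, inv_mul_tsum_geometric]

lemma geomLaw_singleton_ne_zero (k : ℕ) : geomLaw m {k} ≠ 0 := by
  rw [← lintegral_indicator_one (measurableSet_singleton k), lintegral_geomLaw]
  refine fun h => ?_
  have h1 := ENNReal.tsum_eq_zero.1 h k
  have h2 : 1 - (m : ℝ≥0∞)⁻¹ ≠ 0 := (tsub_pos_of_lt (inv_natCast_lt_one m)).ne'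
  simp [h2] at h1

/-- Memorylessness: since every layer is the last one with probability `1 / m`, given that it is
reached, the sum of `a l / m` over the layers `l` up to the outcome has the mean of `a`. -/
lemma lintegral_sum_range_geomLaw (a : ℕ → ℝ≥0∞) :
    ∫⁻ k, ∑ l ∈ Finset.range (k + 1), (m : ℝ≥0∞)⁻¹ * a l ∂geomLaw m = ∫⁻ k, a k ∂geomLaw m := by
  rw [lintegral_geomLaw, lintegral_geomLaw]
  set e : ℝ≥0∞ := (m : ℝ≥0∞)⁻¹
  set q : ℝ≥0∞ := 1 - e
  have h1 : ∀ k, e * q ^ k * ∑ l ∈ Finset.range (k + 1), e * a l =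
      ∑' l, (if l ≤ k then e * q ^ k * (e * a l) else 0) := by
    intro k
    rw [tsum_eq_sum (s := Finset.range (k + 1)), Finset.mul_sum]
    · refine Finset.sum_congr rfl fun l hl => ?_
      rw [if_pos (by simpa [Nat.lt_succ_iff] using hl)]
    · intro l hl
      rw [if_neg (by simpa [Nat.lt_succ_iff] using hl)]
  simp only [h1]
  rw [ENNReal.tsum_comm]
  refine tsum_congr fun l => ?_
  have h2 : ∑' k, (if l ≤ k then e * q ^ k * (e * a l) else 0) =
      ∑' k, e * q ^ (k + l) * (e * a l) := by
    rw [← (add_left_injective l).tsum_eq]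
    · simp
    · intro k hk
      have : l ≤ k := by
        by_contra h
        simp [h] at hk
      exact ⟨k - l, by simp [this]⟩
  rw [h2]
  calc ∑' k, e * q ^ (k + l) * (e * a l) = ∑' k, (e * q ^ l * a l * e) * q ^ k := by
        refine tsum_congr fun k => ?_
        rw [pow_add]; ring
    _ = e * q ^ l * a l * (e * ∑' k, q ^ k) := by rw [ENNReal.tsum_mul_left]; ring
    _ = _ := by rw [inv_mul_tsum_geometric, mul_one]

lemma coe_gridSize (k : ℕ) : (gridSize m k : ℝ≥0∞) = (k + 1) * (m : ℝ≥0∞)⁻¹ := by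
  rw [gridSize, ENNReal.coe_div (by simp [NeZero.ne m]), div_eq_mul_inv]
  simp

lemma gridSize_pos (k : ℕ) : 0 < gridSize m k := by
  have : (0 : ℝ≥0) < m := by exact_mod_cast Nat.pos_of_ne_zero (NeZero.ne m)
  unfold gridSize
  positivity

lemma coe_gridSize_eq_sum (k : ℕ) :
    (gridSize m k : ℝ≥0∞) = ∑ _l ∈ Finset.range (k + 1), (m : ℝ≥0∞)⁻¹ * 1 := by
  simp [coe_gridSize]

lemma sum_ite_eq_min (k l : ℕ) :
    ∑ i ∈ Finset.range (k + 1), (m : ℝ≥0∞)⁻¹ * (if i ≤ l then 1 else 0) =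
      ((min (gridSize m k) (gridSize m l) : ℝ≥0) : ℝ≥0∞) := by
  rw [← (gridSize_mono m).map_min, coe_gridSize_eq_sum]
  simp only [mul_ite, mul_one, mul_zero]
  rw [← Finset.sum_filter]
  refine Finset.sum_congr ?_ fun _ _ => rfl
  ext i
  simp only [Finset.mem_filter, Finset.mem_range]
  omega

lemma lintegral_gridSize : ∫⁻ k, (gridSize m k : ℝ≥0∞) ∂geomLaw m = 1 := by
  simp only [coe_gridSize_eq_sum m]
  rw [lintegral_sum_range_geomLaw m fun _ => 1]
  simp

lemma lintegral_min_gridSize (k : ℕ) :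
    ∫⁻ l, ((min (gridSize m k) (gridSize m l) : ℝ≥0) : ℝ≥0∞) ∂geomLaw m =
      ∑ i ∈ Finset.range (k + 1), (m : ℝ≥0∞)⁻¹ * (1 - (m : ℝ≥0∞)⁻¹) ^ i := by
  simp only [min_comm (gridSize m k), ← sum_ite_eq_min]
  rw [lintegral_sum_range_geomLaw m fun i => if i ≤ k then 1 else 0, lintegral_geomLaw,
    tsum_eq_sum (s := Finset.range (k + 1))]
  · refine Finset.sum_congr rfl fun l hl => ?_
    rw [if_pos (by simpa [Nat.lt_succ_iff] using hl), mul_one]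
  · intro l hl
    rw [if_neg (by simpa [Nat.lt_succ_iff] using hl), mul_zero]

lemma inv_natCast_eq_ofReal : (m : ℝ≥0∞)⁻¹ = ENNReal.ofReal (1 / m) := by
  have : (0 : ℝ) < m := by exact_mod_cast Nat.pos_of_ne_zero (NeZero.ne m)
  rw [one_div, ENNReal.ofReal_inv_of_pos this, ENNReal.ofReal_natCast]

lemma one_sub_inv_natCast_eq_ofReal : 1 - (m : ℝ≥0∞)⁻¹ = ENNReal.ofReal (1 - 1 / m) := by
  rw [inv_natCast_eq_ofReal, ← ENNReal.ofReal_one, ← ENNReal.ofReal_sub _ (by positivity)]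

lemma one_div_natCast_le_half : (1 : ℝ) / m ≤ 1 / 2 :=
  one_div_le_one_div_of_le (by norm_num) (by exact_mod_cast Nat.AtLeastTwo.prop)

lemma lintegral_min_gridSize_prod :
    ∫⁻ k, ∫⁻ l, ((min (gridSize m k) (gridSize m l) : ℝ≥0) : ℝ≥0∞) ∂geomLaw m ∂geomLaw m =
      ENNReal.ofReal (1 / (2 - 1 / m)) := by
  simp only [lintegral_min_gridSize]
  rw [lintegral_sum_range_geomLaw m fun i => (1 - (m : ℝ≥0∞)⁻¹) ^ i, lintegral_geomLaw]
  simp only [mul_assoc, ← mul_pow]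
  have hm := one_div_natCast_le_half m
  have hm0 : (0 : ℝ) < m := by exact_mod_cast Nat.pos_of_ne_zero (NeZero.ne m)
  have hm1 : (0 : ℝ) < 1 / m := by positivity
  rw [ENNReal.tsum_mul_left, ENNReal.tsum_geometric, one_sub_inv_natCast_eq_ofReal,
    inv_natCast_eq_ofReal, ← ENNReal.ofReal_mul (by linarith), ← ENNReal.ofReal_one,
    ← ENNReal.ofReal_sub _ (by nlinarith), ← ENNReal.ofReal_inv_of_pos (by nlinarith),
    ← ENNReal.ofReal_mul (by positivity)]
  congr 1
  set e : ℝ := 1 / m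
  have h1 : (1 : ℝ) - (1 - e) * (1 - e) = e * (2 - e) := by ring
  rw [h1]
  have : (2 : ℝ) - e ≠ 0 := by linarith
  field_simp

lemma le_lintegral_min_one_gridSize :
    ENNReal.ofReal (1 - Real.exp (-1)) ≤
      ∫⁻ k, ((min (gridSize m k) 1 : ℝ≥0) : ℝ≥0∞) ∂geomLaw m := by
  have hm0 : (0 : ℝ) < m := by exact_mod_cast Nat.pos_of_ne_zero (NeZero.ne m)
  have hm := one_div_natCast_le_half m
  obtain ⟨M, hM⟩ : ∃ M, m = M + 1 := Nat.exists_eq_succ_of_ne_zero (NeZero.ne m)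
  -- `1` is the grid size of the outcome `m - 1`.
  have h1 : gridSize m M = 1 := by
    have : ((M : ℝ≥0) + 1) = m := by rw [hM]; push_cast; rfl
    rw [gridSize, this, div_self]
    exact_mod_cast NeZero.ne m
  rw [← h1]
  simp only [min_comm _ (gridSize m M)]
  rw [lintegral_min_gridSize, ← hM, ← Finset.mul_sum, one_sub_inv_natCast_eq_ofReal,
    inv_natCast_eq_ofReal]
  simp only [← ENNReal.ofReal_pow (show (0 : ℝ) ≤ 1 - 1 / m by linarith)]
  rw [← ENNReal.ofReal_sum_of_nonneg fun i _ => pow_nonneg (by linarith) i,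
    ← ENNReal.ofReal_mul (by positivity)]
  refine ENNReal.ofReal_le_ofReal ?_
  have h2 := mul_neg_geom_sum (1 - 1 / (m : ℝ)) m
  rw [sub_sub_cancel] at h2
  rw [h2]
  have := Real.one_sub_div_pow_le_exp_neg (n := m) (t := 1)
    (by exact_mod_cast Nat.one_le_iff_ne_zero.2 (NeZero.ne m))
  linarith

variable {n : ℕ}

/-- Under a product law, one coordinate may be sampled again. -/
lemma lintegral_resample {ι : Type*} [Fintype ι] [DecidableEq ι] (μ : Measure ℕ)
    [IsProbabilityMeasure μ] (f : (ι → ℕ) → ℝ≥0∞) (j : ι) :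
    ∫⁻ k, f k ∂Measure.pi (fun _ : ι => μ) =
      ∫⁻ k, ∫⁻ l, f (Function.update k j l) ∂μ ∂Measure.pi (fun _ : ι => μ) := by
  refine lintegral_eq_of_lmarginal_eq {j} (measurable_of_countable _) (measurable_of_countable _) ?_
  simp only [lmarginal_singleton]
  funext k
  simp

lemma lintegral_pi_eval {ι : Type*} [Fintype ι] [DecidableEq ι] (μ : Measure ℕ)
    [IsProbabilityMeasure μ] (f : ℕ → ℝ≥0∞) (j : ι) :
    ∫⁻ k, f (k j) ∂Measure.pi (fun _ : ι => μ) = ∫⁻ l, f l ∂μ := by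
  rw [lintegral_resample μ _ j]
  simp

lemma lintegral_pi_eval_pair {ι : Type*} [Fintype ι] [DecidableEq ι] (μ : Measure ℕ)
    [IsProbabilityMeasure μ] (f : ℕ → ℕ → ℝ≥0∞) {i j : ι} (hij : i ≠ j) :
    ∫⁻ k, f (k i) (k j) ∂Measure.pi (fun _ : ι => μ) = ∫⁻ a, ∫⁻ b, f a b ∂μ ∂μ := by
  rw [lintegral_resample μ _ j]
  simp only [Function.update_self, Function.update_of_ne hij]
  exact lintegral_pi_eval μ (fun a => ∫⁻ b, f a b ∂μ) i

end GeometricSizes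

/-! ### Expected delays between pairs of jobs -/

section PairBounds

variable {n B : ℕ}

/-- An algorithm does not notice that the size of a hidden job `j` is only `a` while it has
processed `j` for less than `a`; so if it completes `i` in the meantime, the same happens on the
instance in which `j` has size `a`. -/
lemma DetAlgorithm.workBefore_update_lt (D : DetAlgorithm n B) (σ : Equiv.Perm (Fin n))
    {x : Fin n → ℝ≥0} (hx : ∀ i, 0 < x i) {i j : Fin n} (hij : i ≠ j)
    (hj : B ≤ (σ.symm j : ℕ)) {a : ℝ≥0} (ha : 0 < a) (hax : a ≤ x j)
    (hi : completionTime x (D.run σ x) i ≠ ⊤) (hw : workBefore x (D.run σ x) j i < a) :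
    workBefore (Function.update x j a) (D.run σ (Function.update x j a)) j i < a := by
  set x' := Function.update x j a
  have hx' : ∀ i, 0 < x' i := fun k => by
    rcases eq_or_ne k j with rfl | h
    · simpa [x'] using ha
    · simpa [x', h] using hx k
  set t := (completionTime x (D.run σ x) i).toNNReal
  have hagree := D.nonanticipating σ σ x x' hx hx' (fun k hk => ⟨rfl, by
      have : σ k ≠ j := by
        rintro rfl
        simp at hj
        omega
      simp [x', this]⟩) t (fun k => by
      rcases eq_or_ne k j with rfl | h
      · exact Or.inr ⟨hw.trans_le hax, by rw [show x' k = a by simp [x']]; exact hw⟩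
      · exact Or.inl (by simp [x', h]))
  have hit : D.run σ x' i t = x' i := by
    rw [hagree i t le_rfl, (D.isSchedule σ x hx).apply_completionTime hi]
    simp [x', hij]
  have hle : (completionTime x' (D.run σ x') i).toNNReal ≤ t :=
    (ENNReal.toNNReal_mono ENNReal.coe_ne_top (completionTime_le_of_apply_eq hit)).trans_eq
      (ENNReal.toNNReal_coe t)
  calc workBefore x' (D.run σ x') j i ≤ D.run σ x' j t := (D.isSchedule σ x' hx').mono j hle
    _ = D.run σ x j t := hagree j t le_rfl
    _ < a := hw

/-- The instance whose sizes are the grid sizes of the outcomes `k`. -/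
noncomputable def gridInstance (m : ℕ) (k : Fin n → ℕ) : Fin n → ℝ≥0 := fun i => gridSize m (k i)

lemma gridInstance_update (m : ℕ) (k : Fin n → ℕ) (j : Fin n) (l : ℕ) :
    gridInstance m (Function.update k j l) =
      Function.update (gridInstance m k) j (gridSize m l) := by
  funext i
  rcases eq_or_ne i j with rfl | h <;> simp [gridInstance, *]

variable (m : ℕ) [m.AtLeastTwo]

/-- The work of the algorithm on `i` before the completion of `j`, on a grid instance. -/
noncomputable def DetAlgorithm.gridWork (m : ℕ) (D : DetAlgorithm n B) (σ : Equiv.Perm (Fin n))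
    (i j : Fin n) (k : Fin n → ℕ) : ℝ≥0 :=
  workBefore (gridInstance m k) (D.run σ (gridInstance m k)) i j

/-- The algorithm completes every job of every grid instance. -/
def DetAlgorithm.CompletesGrid (m : ℕ) (D : DetAlgorithm n B) (σ : Equiv.Perm (Fin n)) : Prop :=
  ∀ (k : Fin n → ℕ) (i : Fin n),
    completionTime (gridInstance m k) (D.run σ (gridInstance m k)) i ≠ ⊤

lemma gridInstance_pos (k : Fin n → ℕ) (i : Fin n) : 0 < gridInstance m k i := gridSize_pos m _

variable {D : DetAlgorithm n B} {σ : Equiv.Perm (Fin n)}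

lemma DetAlgorithm.CompletesGrid.gridWork_eq_or (hD : D.CompletesGrid m σ) (i j : Fin n)
    (k : Fin n → ℕ) :
    D.gridWork m σ i j k = gridSize m (k i) ∨ D.gridWork m σ j i k = gridSize m (k j) :=
  (D.isSchedule σ _ (gridInstance_pos m k)).workBefore_eq_or (hD k i) (hD k j)

/-- The expected time spent on a hidden job `j` before `i` is complete is at least the
probability that `j` is completed by then: every layer of `j` that is processed costs time `1 / m`
and, by memorylessness, completes `j` with probability `1 / m`. -/
lemma DetAlgorithm.CompletesGrid.lintegral_gridWork_ge (hD : D.CompletesGrid m σ)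
    {i j : Fin n} (hij : i ≠ j) (hj : B ≤ (σ.symm j : ℕ)) (k : Fin n → ℕ) :
    ∫⁻ l, (if D.gridWork m σ j i (Function.update k j l) = gridSize m l then 1 else 0) ∂geomLaw m ≤
      ∫⁻ l, (D.gridWork m σ j i (Function.update k j l) : ℝ≥0∞) ∂geomLaw m := by
  rw [← lintegral_sum_range_geomLaw]
  refine lintegral_mono fun l => ?_
  set w := fun l => D.gridWork m σ j i (Function.update k j l)
  -- The layers in the sum all lie below the processed amount `w l`.
  have hlow : ∀ l' ≤ l, w l' = gridSize m l' → gridSize m l' ≤ w l := by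
    intro l' hl' hw'
    by_contra! hlt
    have := D.workBefore_update_lt σ (gridInstance_pos m (Function.update k j l)) hij hj
      (gridSize_pos m l') (by simpa [gridInstance] using gridSize_mono m hl') (hD _ i) hlt
    rw [gridInstance_update, Function.update_idem, ← gridInstance_update] at this
    exact absurd hw' this.ne
  by_cases hex : ∃ l' ≤ l, w l' = gridSize m l'
  · obtain ⟨L, hLmem, hmax⟩ := Finset.exists_max_image
      ((Finset.range (l + 1)).filter fun l' => w l' = gridSize m l') id
      (by obtain ⟨l', h1, h2⟩ := hex
          exact ⟨l', by simp [h2, h1]⟩)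
    obtain ⟨hL, hLw⟩ : L ≤ l ∧ w L = gridSize m L := by simpa [Nat.lt_succ_iff] using hLmem
    calc ∑ l' ∈ Finset.range (l + 1), (m : ℝ≥0∞)⁻¹ * (if w l' = gridSize m l' then 1 else 0)
        ≤ ∑ l' ∈ Finset.range (l + 1), (m : ℝ≥0∞)⁻¹ * (if l' ≤ L then 1 else 0) := by
          refine Finset.sum_le_sum fun l' hl' => ?_
          gcongr
          split_ifs with h1 h2
          · exact le_rfl
          · exact absurd (hmax l' (by simp [h1, Finset.mem_range.1 hl'])) h2
          · exact zero_le_one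
          · exact le_rfl
      _ ≤ (gridSize m L : ℝ≥0∞) := by
          rw [sum_ite_eq_min]
          exact ENNReal.coe_le_coe.2 (min_le_right _ _)
      _ ≤ w l := by exact_mod_cast hlow L hL hLw
  · push Not at hex
    rw [Finset.sum_eq_zero]
    · exact zero_le
    · intro l' hl'
      rw [if_neg (hex l' (by simpa [Nat.lt_succ_iff] using hl')), mul_zero]

/-- The law of `n` independent geometric outcomes. -/
noncomputable def gridLaw (m n : ℕ) : Measure (Fin n → ℕ) := Measure.pi fun _ => geomLaw m

instance : IsProbabilityMeasure (gridLaw m n) := by unfold gridLaw; infer_instance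

lemma DetAlgorithm.CompletesGrid.lintegral_pair_hidden (hD : D.CompletesGrid m σ)
    {i j : Fin n} (hij : i ≠ j) (hi : B ≤ (σ.symm i : ℕ)) (hj : B ≤ (σ.symm j : ℕ)) :
    1 ≤ ∫⁻ k, ((D.gridWork m σ i j k : ℝ≥0∞) + D.gridWork m σ j i k) ∂gridLaw m n := by
  have key : ∀ {i j : Fin n}, i ≠ j → B ≤ (σ.symm j : ℕ) →
      ∫⁻ k, (if D.gridWork m σ j i k = gridSize m (k j) then 1 else 0) ∂gridLaw m n ≤
        ∫⁻ k, (D.gridWork m σ j i k : ℝ≥0∞) ∂gridLaw m n := by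
    intro i j hij hj
    unfold gridLaw
    rw [lintegral_resample _ _ j, lintegral_resample _ (fun k => (D.gridWork m σ j i k : ℝ≥0∞)) j]
    refine lintegral_mono fun k => ?_
    simpa using hD.lintegral_gridWork_ge m hij hj k
  rw [lintegral_add_left (measurable_of_countable _)]
  refine le_trans ?_ (add_le_add (key hij.symm hi) (key hij hj))
  rw [← lintegral_add_left (measurable_of_countable _)]
  calc (1 : ℝ≥0∞) = ∫⁻ _, 1 ∂gridLaw m n := by simp
    _ ≤ _ := lintegral_mono fun k => by
        rcases hD.gridWork_eq_or m i j k with h | h <;> simp [h]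

lemma DetAlgorithm.CompletesGrid.lintegral_pair_known_hidden (hD : D.CompletesGrid m σ)
    {i j : Fin n} (hij : i ≠ j) (hj : B ≤ (σ.symm j : ℕ)) :
    ENNReal.ofReal (1 - Real.exp (-1)) ≤
      ∫⁻ k, ((D.gridWork m σ i j k : ℝ≥0∞) + D.gridWork m σ j i k) ∂gridLaw m n := by
  refine (le_lintegral_min_one_gridSize m).trans ?_
  rw [← lintegral_pi_eval _ (fun a => ((min (gridSize m a) 1 : ℝ≥0) : ℝ≥0∞)) i]
  unfold gridLaw
  rw [lintegral_resample _ (fun k => (D.gridWork m σ i j k : ℝ≥0∞) + D.gridWork m σ j i k) j]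
  refine lintegral_mono fun k => ?_
  -- With the size of `i` fixed, either `j` finishes first, at an expected cost of at least its
  -- probability, or the whole of `i` is processed before `j` is complete.
  rw [lintegral_add_left (measurable_of_countable _)]
  refine le_trans ?_ (add_le_add le_rfl (hD.lintegral_gridWork_ge m hij hj k))
  rw [← lintegral_add_left (measurable_of_countable _)]
  calc ((min (gridSize m (k i)) 1 : ℝ≥0) : ℝ≥0∞)
      = ∫⁻ _, ((min (gridSize m (k i)) 1 : ℝ≥0) : ℝ≥0∞) ∂geomLaw m := by simp
    _ ≤ _ := lintegral_mono fun l => by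
        rcases hD.gridWork_eq_or m i j (Function.update k j l) with h | h
        · rw [Function.update_of_ne hij] at h
          rw [h]
          refine le_trans ?_ le_self_add
          exact ENNReal.coe_le_coe.2 (min_le_left _ _)
        · rw [Function.update_self] at h
          rw [if_pos h]
          refine le_trans ?_ le_add_self
          exact ENNReal.coe_le_coe.2 (min_le_right _ _)

lemma DetAlgorithm.CompletesGrid.lintegral_pair (hD : D.CompletesGrid m σ)
    {i j : Fin n} (hij : i ≠ j) :
    ENNReal.ofReal (1 / (2 - 1 / m)) ≤
      ∫⁻ k, ((D.gridWork m σ i j k : ℝ≥0∞) + D.gridWork m σ j i k) ∂gridLaw m n := by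
  rw [← lintegral_min_gridSize_prod]
  unfold gridLaw
  rw [← lintegral_pi_eval_pair (geomLaw m)
    (fun a b => ((min (gridSize m a) (gridSize m b) : ℝ≥0) : ℝ≥0∞)) hij]
  refine lintegral_mono fun k => ?_
  rcases hD.gridWork_eq_or m i j k with h | h
  · rw [h]
    refine le_trans ?_ le_self_add
    exact ENNReal.coe_le_coe.2 (min_le_left _ _)
  · rw [h]
    refine le_trans ?_ le_add_self
    exact ENNReal.coe_le_coe.2 (min_le_right _ _)

/-- The least expected delay that two jobs cause to each other when their sizes are independent
exponential variables of mean `1`, for the jobs in positions `a` and `b` of a list whose first `B`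
jobs have known sizes: `𝔼 min(X, Y)`, `𝔼 min(X, 1)` or `1` if two, one or none of them are known. -/
noncomputable def pairBound (B a b : ℕ) : ℝ :=
  if a < B then if b < B then 1 / 2 else 1 - Real.exp (-1)
  else if b < B then 1 - Real.exp (-1) else 1

lemma pairBound_nonneg (B a b : ℕ) : 0 ≤ pairBound B a b := by
  have : Real.exp (-1) ≤ 1 := Real.exp_le_one_iff.2 (by norm_num)
  unfold pairBound
  split_ifs <;> linarith

lemma DetAlgorithm.CompletesGrid.pairBound_le (hD : D.CompletesGrid m σ)
    {i j : Fin n} (hij : i ≠ j) :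
    ENNReal.ofReal (pairBound B (σ.symm i) (σ.symm j)) ≤
      ∫⁻ k, ((D.gridWork m σ i j k : ℝ≥0∞) + D.gridWork m σ j i k) ∂gridLaw m n := by
  unfold pairBound
  split_ifs with h1 h2 h2
  · refine le_trans (ENNReal.ofReal_le_ofReal ?_) (hD.lintegral_pair m hij)
    have := one_div_natCast_le_half m
    have h0 : (0 : ℝ) ≤ 1 / m := by positivity
    exact one_div_le_one_div_of_le (by linarith) (by linarith)
  · exact hD.lintegral_pair_known_hidden m hij (not_lt.1 h2)
  · simpa only [add_comm] using hD.lintegral_pair_known_hidden m hij.symm (not_lt.1 h1)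
  · simpa using hD.lintegral_pair_hidden m hij (not_lt.1 h1) (not_lt.1 h2)

lemma sum_pairBound (hB : B ≤ n) (σ : Equiv.Perm (Fin n)) :
    ∑ j, ∑ i ∈ Finset.univ.erase j, pairBound B (σ.symm i) (σ.symm j) =
      B * (B - 1) / 2 + 2 * B * (n - B) * (1 - Real.exp (-1)) + (n - B) * (n - B - 1) := by
  have h1 : ∀ j, ∑ i ∈ Finset.univ.erase j, pairBound B (σ.symm i) (σ.symm j) =
      ∑ i : Fin n, pairBound B i (σ.symm j) - pairBound B (σ.symm j) (σ.symm j) := by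
    intro j
    rw [← Equiv.sum_comp σ.symm (fun i : Fin n => pairBound B i (σ.symm j)), eq_sub_iff_add_eq,
      Finset.sum_erase_add _ _ (Finset.mem_univ j)]
  have hcount : ∀ a b : ℝ, ∑ i : Fin n, (if (i : ℕ) < B then a else b) = B * a + (n - B) * b := by
    intro a b
    obtain ⟨d, rfl⟩ := Nat.exists_eq_add_of_le hB
    rw [Fin.sum_univ_eq_sum_range (fun i => if i < B then a else b), Finset.sum_range_add,
      Finset.sum_congr rfl (fun i hi => if_pos (Finset.mem_range.1 hi))]
    simp
  simp only [h1]
  rw [Equiv.sum_comp σ.symm (fun j : Fin n =>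
    ∑ i : Fin n, pairBound B i j - pairBound B j j)]
  have h2 : ∀ j : Fin n, ∑ i : Fin n, pairBound B i j - pairBound B j j =
      if (j : ℕ) < B then B * (1 / 2) + (n - B) * (1 - Real.exp (-1)) - 1 / 2
      else B * (1 - Real.exp (-1)) + (n - B) * 1 - 1 := by
    intro j
    unfold pairBound
    by_cases hj : (j : ℕ) < B
    · simp only [hj, if_true, hcount]
    · simp only [hj, if_false, hcount]
  simp only [h2, hcount]
  ring

lemma lintegral_sum_gridSize (n : ℕ) :
    ∫⁻ k : Fin n → ℕ, ∑ i, (gridInstance m k i : ℝ≥0∞) ∂gridLaw m n = n := by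
  rw [lintegral_finsetSum _ fun _ _ => measurable_of_countable _]
  have : ∀ i : Fin n, ∫⁻ k : Fin n → ℕ, (gridInstance m k i : ℝ≥0∞) ∂gridLaw m n = 1 := fun i =>
    (lintegral_pi_eval _ (fun a => (gridSize m a : ℝ≥0∞)) i).trans (lintegral_gridSize m)
  simp [this]

/-- The expected objective of every deterministic algorithm on the random grid instance. -/
lemma DetAlgorithm.le_lintegral_total (hB : B ≤ n) (D : DetAlgorithm n B)
    (σ : Equiv.Perm (Fin n)) :
    ENNReal.ofReal (2 * n + (B * (B - 1) / 2 + 2 * B * (n - B) * (1 - Real.exp (-1)) +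
        (n - B) * (n - B - 1))) ≤
      2 * ∫⁻ k, totalCompletionTime (gridInstance m k) (D.run σ (gridInstance m k))
        ∂gridLaw m n := by
  by_cases hD : D.CompletesGrid m σ
  · rw [← sum_pairBound hB σ, ENNReal.ofReal_add (by positivity)
      (Finset.sum_nonneg fun _ _ => Finset.sum_nonneg fun _ _ => pairBound_nonneg _ _ _),
      ENNReal.ofReal_sum_of_nonneg
        (fun _ _ => Finset.sum_nonneg fun _ _ => pairBound_nonneg _ _ _)]
    rw [← lintegral_const_mul _ (measurable_of_countable _)]
    calc _ ≤ 2 * (n : ℝ≥0∞) + ∑ j, ∑ i ∈ Finset.univ.erase j,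
          ∫⁻ k, ((D.gridWork m σ i j k : ℝ≥0∞) + D.gridWork m σ j i k) ∂gridLaw m n := by
          refine add_le_add (by simp [ENNReal.ofReal_mul]) (Finset.sum_le_sum fun j _ => ?_)
          rw [ENNReal.ofReal_sum_of_nonneg fun _ _ => pairBound_nonneg _ _ _]
          exact Finset.sum_le_sum fun i hi => hD.pairBound_le m (Finset.ne_of_mem_erase hi)
      _ = ∫⁻ k, (2 * ∑ j, (gridInstance m k j : ℝ≥0∞) + ∑ j, ∑ i ∈ Finset.univ.erase j,
          ((D.gridWork m σ i j k : ℝ≥0∞) + D.gridWork m σ j i k)) ∂gridLaw m n := by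
          rw [lintegral_add_left (measurable_of_countable _),
            lintegral_const_mul _ (measurable_of_countable _), lintegral_sum_gridSize,
            lintegral_finsetSum _ fun _ _ => measurable_of_countable _]
          congr 1
          refine Finset.sum_congr rfl fun j _ => ?_
          rw [lintegral_finsetSum _ fun _ _ => measurable_of_countable _]
      _ ≤ _ := lintegral_mono fun k =>
          (D.isSchedule σ _ (gridInstance_pos m k)).two_mul_total_ge (hD k)
  · -- An incomplete job on some grid instance makes the expectation infinite, since every grid
    -- instance has positive probability.
    unfold DetAlgorithm.CompletesGrid at hD
    push Not at hD
    obtain ⟨k, i, hki⟩ := hD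
    have htop : totalCompletionTime (gridInstance m k) (D.run σ (gridInstance m k)) = ⊤ :=
      ENNReal.sum_eq_top.2 ⟨i, Finset.mem_univ i, hki⟩
    have hpos : gridLaw m n {k} ≠ 0 := by
      rw [gridLaw, Measure.pi_singleton]
      exact Finset.prod_ne_zero_iff.2 fun i _ => geomLaw_singleton_ne_zero m _
    have : ∫⁻ k, totalCompletionTime (gridInstance m k) (D.run σ (gridInstance m k))
        ∂gridLaw m n = ⊤ := by
      refine top_unique ?_
      calc (⊤ : ℝ≥0∞) = ∫⁻ k in {k},
            totalCompletionTime (gridInstance m k) (D.run σ (gridInstance m k)) ∂gridLaw m n := by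
            rw [lintegral_singleton, htop, ENNReal.top_mul hpos]
        _ ≤ _ := setLIntegral_le_lintegral _ _
    rw [this]
    simp

/-- The expected offline optimum on the random grid instance. -/
lemma lintegral_opt_le (n : ℕ) :
    2 * ∫⁻ k : Fin n → ℕ, opt (gridInstance m k) ∂gridLaw m n ≤
      ENNReal.ofReal (2 * n + n * (n - 1) * (1 / (2 - 1 / m))) := by
  have hm := one_div_natCast_le_half m
  have hc : (0 : ℝ) ≤ 1 / (2 - 1 / m) := one_div_nonneg.2 (by linarith)
  rw [← lintegral_const_mul _ (measurable_of_countable _)]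
  refine (lintegral_mono fun k => two_mul_opt_le (gridInstance m k)).trans ?_
  have hpair : ∀ i j : Fin n, ∫⁻ k : Fin n → ℕ,
      ((min (gridInstance m k i) (gridInstance m k j) : ℝ≥0) : ℝ≥0∞) ∂gridLaw m n =
      ENNReal.ofReal (if i = j then 1 else 1 / (2 - 1 / m)) := by
    intro i j
    split_ifs with h
    · subst h
      simp only [min_self, ENNReal.ofReal_one]
      exact (lintegral_pi_eval _ (fun a => (gridSize m a : ℝ≥0∞)) i).trans (lintegral_gridSize m)
    · rw [← lintegral_min_gridSize_prod]
      exact lintegral_pi_eval_pair (geomLaw m)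
        (fun a b => ((min (gridSize m a) (gridSize m b) : ℝ≥0) : ℝ≥0∞)) h
  rw [lintegral_add_left (measurable_of_countable _), lintegral_sum_gridSize,
    lintegral_finsetSum _ fun _ _ => measurable_of_countable _]
  have hnn : ∀ i j : Fin n, (0 : ℝ) ≤ if i = j then 1 else (1 / (2 - 1 / m) : ℝ) := by
    intro i j
    split_ifs <;> linarith
  have hsum : ∀ i : Fin n, ∫⁻ k : Fin n → ℕ,
      ∑ j, ((min (gridInstance m k i) (gridInstance m k j) : ℝ≥0) : ℝ≥0∞) ∂gridLaw m n =
      ENNReal.ofReal (1 + (n - 1) * (1 / (2 - 1 / m))) := by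
    intro i
    rw [lintegral_finsetSum _ fun _ _ => measurable_of_countable _]
    simp only [hpair]
    rw [← ENNReal.ofReal_sum_of_nonneg fun j _ => hnn i j]
    congr 1
    have hcard : ((n - 1 : ℕ) : ℝ) = n - 1 := by
      have := i.pos
      push_cast [Nat.cast_sub (show 1 ≤ n from this)]; ring
    rw [← Finset.add_sum_erase _ _ (Finset.mem_univ i), if_pos rfl,
      Finset.sum_congr rfl fun j hj => if_neg (Finset.ne_of_mem_erase hj).symm]
    simp [hcard]
  rw [Finset.sum_congr rfl fun i _ => hsum i]
  rw [Finset.sum_const, Finset.card_univ, Fintype.card_fin, nsmul_eq_mul,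
    ← ENNReal.ofReal_natCast, ← ENNReal.ofReal_mul (by positivity)]
  rcases Nat.eq_zero_or_pos n with rfl | hn
  · simp
  have h1 : (1 : ℝ) ≤ n := by exact_mod_cast hn
  rw [← ENNReal.ofReal_add (by positivity) (mul_nonneg (by positivity)
    (add_nonneg zero_le_one (mul_nonneg (by linarith) hc)))]
  exact ENNReal.ofReal_le_ofReal (by linarith)

end PairBounds

/-! ### The competitive ratio -/

section Conclusion

variable {n B : ℕ}

lemma opt_ne_top (x : Fin n → ℝ≥0) : opt x ≠ ⊤ := by
  intro h
  have := two_mul_opt_le x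
  rw [h, ENNReal.mul_top two_ne_zero, top_le_iff] at this
  refine ENNReal.add_ne_top.2 ⟨?_, ?_⟩ this
  · simp [ENNReal.sum_eq_top]
  · simp only [ne_eq, ENNReal.sum_eq_top, not_exists, not_and]
    exact fun i _ j _ => ENNReal.coe_ne_top

lemma Algorithm.expectedCost_le (A : Algorithm.{u} n B) {x : Fin n → ℝ≥0} (hx : ∀ i, 0 < x i)
    (hA : A.ratio ≠ ⊤) : A.expectedCost x ≤ A.ratio * opt x :=
  (ENNReal.div_le_iff_le_mul (Or.inr hA) (Or.inl (opt_ne_top x))).1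
    (le_iSup₂ (f := fun x (_ : ∀ i, 0 < x i) => A.expectedCost x / opt x) x hx)

/-- Averaging over the random grid instance bounds the ratio on its worst instance. The order of
integration may be exchanged because the law of the instance has countable support; runs are not
assumed to be measurable in the sizes. -/
lemma Algorithm.ratio_mul_ge (m : ℕ) [m.AtLeastTwo] (hB : B ≤ n) (A : Algorithm.{u} n B)
    (hA : A.ratio ≠ ⊤) :
    ENNReal.ofReal (2 * n + (B * (B - 1) / 2 + 2 * B * (n - B) * (1 - Real.exp (-1)) +
        (n - B) * (n - B - 1))) ≤
      A.ratio * ENNReal.ofReal (2 * n + n * (n - 1) * (1 / (2 - 1 / m))) := by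
  set L := ENNReal.ofReal (2 * n + (B * (B - 1) / 2 + 2 * B * (n - B) * (1 - Real.exp (-1)) +
        (n - B) * (n - B - 1))) with hL
  have hfac : ((n.factorial : ℕ) : ℝ≥0∞) ≠ 0 := by exact_mod_cast n.factorial_ne_zero
  have hmeas : ∀ (σ : Equiv.Perm (Fin n)) (k : Fin n → ℕ), Measurable fun ω =>
      totalCompletionTime (gridInstance m k) ((A.det ω).run σ (gridInstance m k)) := fun σ k =>
    measurable_totalCompletionTime _ _
      (fun ω => (A.det ω).isSchedule σ _ (gridInstance_pos m k))
      (A.measurable_run σ _ (gridInstance_pos m k))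
  have hσ : ∀ σ : Equiv.Perm (Fin n), L ≤ 2 * ∫⁻ k, ∫⁻ ω,
      totalCompletionTime (gridInstance m k) ((A.det ω).run σ (gridInstance m k)) ∂A.law
        ∂gridLaw m n := by
    intro σ
    rw [lintegral_lintegral_swap]
    · rw [← lintegral_const_mul']
      · calc L = ∫⁻ _, L ∂A.law := by simp
          _ ≤ _ := lintegral_mono fun ω => (A.det ω).le_lintegral_total m hB σ
      · simp
    · exact (measurable_from_prod_countable_right (hmeas σ)).aemeasurable
  calc L = (∑ _σ : Equiv.Perm (Fin n), L) / (n.factorial : ℝ≥0∞) := by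
        rw [Finset.sum_const, Finset.card_univ, Fintype.card_perm, Fintype.card_fin, nsmul_eq_mul,
          mul_comm, ENNReal.mul_div_cancel_right hfac (by simp)]
    _ ≤ (∑ σ : Equiv.Perm (Fin n), 2 * ∫⁻ k, ∫⁻ ω,
        totalCompletionTime (gridInstance m k) ((A.det ω).run σ (gridInstance m k)) ∂A.law
          ∂gridLaw m n) / (n.factorial : ℝ≥0∞) := by
        gcongr with σ
        exact hσ σ
    _ = 2 * ∫⁻ k, A.expectedCost (gridInstance m k) ∂gridLaw m n := by
        simp only [Algorithm.expectedCost, div_eq_mul_inv]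
        rw [lintegral_mul_const _ (measurable_of_countable _),
          lintegral_finsetSum _ fun _ _ => measurable_of_countable _, ← Finset.mul_sum, mul_assoc]
    _ ≤ 2 * ∫⁻ k, A.ratio * opt (gridInstance m k) ∂gridLaw m n := by
        gcongr with k
        exact A.expectedCost_le (gridInstance_pos m k) hA
    _ = A.ratio * (2 * ∫⁻ k, opt (gridInstance m k) ∂gridLaw m n) := by
        rw [lintegral_const_mul _ (measurable_of_countable _)]
        ring
    _ ≤ _ := by
        gcongr
        exact lintegral_opt_le m n

lemma Algorithm.boundConst_le_ratio (hn : 2 ≤ n) (hB : B ≤ n) (A : Algorithm.{u} n B) :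
    ENNReal.ofReal (boundConst n B - 4 * (boundConst n B - 1) / ((n : ℝ) + 3)) ≤ A.ratio := by
  rcases eq_or_ne A.ratio ⊤ with hA | hA
  · simp [hA]
  refine ENNReal.ofReal_le_of_le_toReal ?_
  set r := A.ratio.toReal
  have hn' : (2 : ℝ) ≤ n := by exact_mod_cast hn
  have hr0 : 0 ≤ r := ENNReal.toReal_nonneg
  have hfin : ∀ m : ℕ, 2 * (n : ℝ) + (B * (B - 1) / 2 + 2 * B * (n - B) * (1 - Real.exp (-1)) +
      (n - B) * (n - B - 1)) ≤ r * (2 * n + n * (n - 1) * (1 / (2 - 1 / ((m + 2 : ℕ) : ℝ)))) := by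
    intro m
    have h := A.ratio_mul_ge (m + 2) hB hA
    have hm := one_div_natCast_le_half (m + 2)
    have hU : 0 ≤ 2 * (n : ℝ) + n * (n - 1) * (1 / (2 - 1 / ((m + 2 : ℕ) : ℝ))) :=
      add_nonneg (by positivity) (mul_nonneg (mul_nonneg (by positivity) (by linarith))
        (one_div_nonneg.2 (by linarith)))
    rw [← ENNReal.ofReal_toReal hA, ← ENNReal.ofReal_mul hr0] at h
    exact (ENNReal.ofReal_le_ofReal_iff (mul_nonneg hr0 hU)).1 h
  -- As the grid is refined, `𝔼 min(X, Y)` tends to its value `1 / 2` for exponential sizes.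
  have hlim : Tendsto (fun m : ℕ => r * (2 * (n : ℝ) + n * (n - 1) *
      (1 / (2 - 1 / ((m + 2 : ℕ) : ℝ))))) atTop
      (nhds (r * (2 * (n : ℝ) + n * (n - 1) * (1 / (2 - 0))))) := by
    have h0 : Tendsto (fun m : ℕ => 1 / ((m + 2 : ℕ) : ℝ)) atTop (nhds 0) :=
      (tendsto_add_atTop_iff_nat 2).2 tendsto_one_div_atTop_nhds_zero_nat
    exact ((((tendsto_const_nhds (x := (1 : ℝ))).div ((tendsto_const_nhds (x := (2 : ℝ))).sub h0)
      (by norm_num)).const_mul _).const_add _).const_mul r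
  have hle := ge_of_tendsto' hlim hfin
  have hexp : (4 : ℝ) / Real.exp 1 = 4 * Real.exp (-1) := by rw [Real.exp_neg]; rfl
  have hid : (boundConst n B - 4 * (boundConst n B - 1) / ((n : ℝ) + 3)) *
      (2 * n + n * (n - 1) * (1 / (2 - 0))) = 2 * (n : ℝ) + (B * (B - 1) / 2 +
        2 * B * (n - B) * (1 - Real.exp (-1)) + (n - B) * (n - B - 1)) := by
    unfold boundConst
    rw [hexp]
    have h1 : (n : ℝ) - 1 ≠ 0 := by linarith
    have h2 : (n : ℝ) + 3 ≠ 0 := by linarith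
    have h3 : (n : ℝ) ≠ 0 := by linarith
    field_simp
    ring
  rw [← hid] at hle
  refine le_of_mul_le_mul_right hle ?_
  nlinarith

lemma tendsto_boundConst {B : ℕ → ℕ} {w : ℝ}
    (hB : (fun n : ℕ => (B n : ℝ) - w * (n : ℝ)) =o[atTop] (fun n : ℕ => (n : ℝ))) :
    Tendsto (fun n : ℕ => boundConst n (B n) - 4 * (boundConst n (B n) - 1) / ((n : ℝ) + 3)) atTop
      (nhds ((2 - w) - (4 / Real.exp 1 - 1) * w * (1 - w))) := by
  have h1 : Tendsto (fun n : ℕ => (B n : ℝ) / n) atTop (nhds w) := by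
    have h := hB.tendsto_div_nhds_zero.add_const w
    rw [zero_add] at h
    refine h.congr' ?_
    filter_upwards [eventually_gt_atTop 0] with n hn
    have : (n : ℝ) ≠ 0 := by exact_mod_cast hn.ne'
    field_simp
    ring
  have hinv : Tendsto (fun n : ℕ => (n : ℝ)⁻¹) atTop (nhds 0) := tendsto_inv_atTop_nhds_zero_nat
  have h2 : Tendsto (fun n : ℕ => ((B n : ℝ) - 1) / ((n : ℝ) - 1)) atTop (nhds w) := by
    have h := (h1.sub hinv).div (tendsto_const_nhds (x := (1 : ℝ)).sub hinv) (by norm_num)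
    rw [sub_zero, sub_zero, div_one] at h
    refine h.congr' ?_
    filter_upwards [eventually_gt_atTop 1] with n hn
    have h3 : (n : ℝ) ≠ 0 := by positivity
    have h4 : (n : ℝ) - 1 ≠ 0 := by
      have : (1 : ℝ) < n := by exact_mod_cast hn
      linarith
    simp only [Pi.div_apply]
    field_simp
  have h3 : Tendsto (fun n : ℕ => boundConst n (B n)) atTop
      (nhds (2 - w - (4 / Real.exp 1 - 1) * w * (1 - w))) :=
    (h1.const_sub 2).sub ((h1.const_mul _).mul (h2.const_sub 1))
  have h4 : Tendsto (fun n : ℕ => (n : ℝ) + 3) atTop atTop :=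
    tendsto_atTop_add_const_right _ _ tendsto_natCast_atTop_atTop
  simpa using h3.sub (((h3.sub_const 1).const_mul 4).div_atTop h4)

end Conclusion

end PartialScheduling

theorem corollary1 :
    (∀ (n B : ℕ), 2 ≤ n → B ≤ n → ∀ A : PartialScheduling.Algorithm.{u} n B,
      ENNReal.ofReal (PartialScheduling.boundConst n B
          - 4 * (PartialScheduling.boundConst n B - 1) / ((n : ℝ) + 3)) ≤ A.ratio) ∧
    (∀ (B : ℕ → ℕ) (w : ℝ), (∀ n, 2 ≤ n → B n ≤ n) →
      (fun n : ℕ => (B n : ℝ) - w * (n : ℝ)) =o[atTop] (fun n : ℕ => (n : ℝ)) →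
      ∀ A : (∀ n, PartialScheduling.Algorithm.{u} n (B n)),
        ENNReal.ofReal ((2 - w) - (4 / Real.exp 1 - 1) * w * (1 - w))
          ≤ PartialScheduling.competitiveRatio A) := by
  refine ⟨fun n B hn hB A => A.boundConst_le_ratio hn hB, fun B w hBn hw A => ?_⟩
  refine le_of_tendsto (ENNReal.tendsto_ofReal (PartialScheduling.tendsto_boundConst hw)) ?_
  filter_upwards [eventually_ge_atTop 2] with n hn
  exact ((A n).boundConst_le_ratio hn (hBn n hn)).trans
    (le_iSup₂ (f := fun n (_ : 2 ≤ n) => (A n).ratio) n hn)
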